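/- Let $X$ be a nonempty finite alphabet, $Q$ a finite set, and $\Phi\colon X\times Q\to Q\times X$ a Mealy automaton. Each state $q\in Q$ acts on the right on $X^*$ by $\varepsilon^q=\varepsilon$ and $(xw)^q=y\,(w^t)$ when $\Phi(x,q)=(t,y)$; let $G(\Phi)$ be the semigroup (with identity) of self-maps of $X^*$ generated by the states, and write $\overline g\in G(\Phi)$ for the value of a word $g\in Q^*$. For $g=q_1\cdots q_k\in Q^*$ and $x\in X$ put $x_0=x$ and $(t_i,x_i)=\Phi(x_{i-1},q_i)$, and let $g@x=t_1\cdots t_k$; extend this to $u\in X^*$ by $g@\varepsilon=g$ and $g@(xu)=(g@x)@u$. Let $|\cdot|$ be the word metric on $G(\Phi)$ with respect to $Q$. The automaton is \emph{nuclear} if for every $g\in Q^*$ there is $n\in\mathbb N$ such that for all $u\in X^n$ there is $q\in Q$ with $\overline{g@u}=\overline q$. Proposition. Suppose that $\Phi$ is nuclear. Then the word problem in $G(\Phi)$ (given $u,v\in Q^*$, is $\overline u=\overline v$?) is solvable in polynomial time on a multi-stack (equivalently, multi-tape) Turing machine. More precisely, there is $n\in\mathbb N$ with $$|\overline{g@v}|\le\tfrac12\bigl(|\overline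 g|+1\bigr)\qquad\text{for all }g\in Q^*,\ v\in X^n,$$ and for every such $n$, setting $d=n\log_2(\#X)$, the word problem is solved by such a machine in time $O(\ell^{d})$ if $d>1$, and in time $O(\ell\log\ell)$ if $d\le1$, where $\ell=|u|+|v|+1$ is the length of the input and the implied constant depends only on $\Phi$ and $n$. -/

import Mathlib

open Filter Asymptotics

namespace MealyAutomaton

/-! A Mealy automaton with stateset `Q` and alphabet `X` is a map `Φ : X × Q → Q × X`;
`Φ (x, q) = (t, y)` is the transition from `q` to `t` with input `x` and output `y`. -/

variable {X Q : Type}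

/-- The transformation `w ↦ w ^ q` of `X*` given by a state `q`: `ε ^ q = ε`, and
`(x w) ^ q = y (w ^ t)` whenever `Φ (x, q) = (t, y)`. -/
def act (Φ : X × Q → Q × X) : Q → List X → List X
  | _, [] => []
  | q, x :: w => (Φ (x, q)).2 :: act Φ (Φ (x, q)).1 w

/-- The semigroup `G(Φ)` (with identity) of self-maps of `X*` generated by the states.
Maps act on the right, whence the opposite of the monoid of self-maps under composition. -/
def semigroup (Φ : X × Q → Q × X) : Submonoid (Function.End (List X))ᵐᵒᵖ :=
  Submonoid.closure (Set.range fun q => MulOpposite.op (act Φ q : Function.End (List X)))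

/-- The element of `G(Φ)` given by a state. -/
def generator (Φ : X × Q → Q × X) (q : Q) : semigroup Φ :=
  ⟨MulOpposite.op (act Φ q : Function.End (List X)), Submonoid.subset_closure ⟨q, rfl⟩⟩

/-- The evaluation map `Q* → G(Φ)`: `q₁ ⋯ qₖ` acts by `q₁` first and by `qₖ` last. -/
def eval (Φ : X × Q → Q × X) (g : List Q) : semigroup Φ :=
  (g.map (generator Φ)).prod

/-- The action of a word over `Q` on a letter: for `g = q₁ ⋯ qₖ` and `x = x₀`, the pair
`(t₁ ⋯ tₖ, xₖ)` with `Φ (xᵢ₋₁, qᵢ) = (tᵢ, xᵢ)` for all `i`. -/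
def step (Φ : X × Q → Q × X) : X → List Q → List Q × X
  | x, [] => ([], x)
  | x, q :: g =>
    ((Φ (x, q)).1 :: (step Φ (Φ (x, q)).2 g).1, (step Φ (Φ (x, q)).2 g).2)

/-- The state `g @ u ∈ Q*` of a word `g ∈ Q*` at a word `u ∈ X*`. -/
def stateAt (Φ : X × Q → Q × X) : List Q → List X → List Q
  | g, [] => g
  | g, x :: u => stateAt Φ (step Φ x g).1 u

/-- `Φ` is nuclear: for every `g ∈ Q*` there is `n` such that for all `u ∈ X ^ n` the element of
`G(Φ)` given by `g @ u` is given by a single state. -/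
def IsNuclear (Φ : X × Q → Q × X) : Prop :=
  ∀ g : List Q, ∃ n : ℕ, ∀ u : List X, u.length = n →
    eval Φ (stateAt Φ g u) ∈ Set.range (generator Φ)

/-- The word metric on `G(Φ)`: the least length of a word over `Q` that evaluates to `a`. -/
noncomputable def wordLength (Φ : X × Q → Q × X) (a : semigroup Φ) : ℕ :=
  sInf {k : ℕ | ∃ g : List Q, g.length = k ∧ eval Φ g = a}

/-- Word length halves at depth `n`: `|g @ v| ≤ (|g| + 1) / 2` for all elements `g` of `G(Φ)`
and all `v ∈ X ^ n`. -/
def HalvesAtDepth (Φ : X × Q → Q × X) (n : ℕ) : Prop :=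
  ∀ (g : List Q) (v : List X), v.length = n →
    (wordLength Φ (eval Φ (stateAt Φ g v)) : ℝ) ≤ ((wordLength Φ (eval Φ g) : ℝ) + 1) / 2

open Classical in
/-- The word problem in `G(Φ)`: given words `u, v` over `Q`, do they evaluate to the same
element of `G(Φ)`? -/
noncomputable def wordProblem (Φ : X × Q → Q × X) (p : List Q × List Q) : Bool :=
  decide (eval Φ p.1 = eval Φ p.2)

/-- A pair of words written on a tape: the two words with the separator `none` in between. -/
def encodePair (p : List Q × List Q) : List (Option Q) :=
  p.1.map some ++ none :: p.2.map some

end MealyAutomaton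

/-! States of products obey `(gh)@u = (g@u)(h@u^g)`, and the value of `g@u` depends only on that of
`g`. There are finitely many pairs of states, so nuclearity yields one depth `n` at which every
product of two states has the value of a single state. Grouping the letters of a shortest word in
pairs then gives `|g@v| ≤ (|g|+1)/2`. Conversely, halving at depth `n` forces the states of a
product of two letters to have length less than 2, so any such `n` has the pair property.

Let `N = #X^n`. Two words have the same value if and only if they act alike on `X^n` and have states
of equal value at each of the `N` words of length `n` (`eval_eq_iff_of_depth`). A finite transducer
that remembers the current image of `u ∈ X^n` and reads letters in pairs replaces `g` by a word of
half the length with the value of `g@u` (`compress_spec`). Running it for all `u` and both words at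
once reduces one problem, in linear time, to `N` problems of half the size; problems of size one are
read off a finite table.

A stack machine explores this recursion depth first, so `T(2m) ≤ N T(m) + O(m)`. This gives exponent
`log₂ N = n log₂ #X` when `N > 2`, and `ℓ log ℓ` when `N ≤ 2`. -/

namespace MealyAutomaton

/-! ### Actions and states of words -/

section WordAction

variable {X Q : Type} (Φ : X × Q → Q × X)

/-- The action of a word over `Q` on `X*`, first letter first. -/
def actWord : List Q → List X → List X
  | [], w => w
  | q :: g, w => actWord g (act Φ q w)

theorem unop_eval (g : List Q) :
    MulOpposite.unop (eval Φ g : (Function.End (List X))ᵐᵒᵖ) =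
      (actWord Φ g : Function.End (List X)) := by
  induction g with
  | nil => rfl
  | cons q g ih =>
    have h : eval Φ (q :: g) = generator Φ q * eval Φ g := by simp [eval]
    rw [h, Submonoid.coe_mul, MulOpposite.unop_mul, ih]
    rfl

theorem eval_eq_iff {g h : List Q} : eval Φ g = eval Φ h ↔ actWord Φ g = actWord Φ h := by
  have e : actWord Φ g = actWord Φ h ↔
      MulOpposite.unop (eval Φ g : (Function.End (List X))ᵐᵒᵖ) =
        MulOpposite.unop (eval Φ h : (Function.End (List X))ᵐᵒᵖ) := by
    rw [unop_eval, unop_eval]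
    rfl
  rw [e, MulOpposite.unop_inj, Subtype.coe_inj]

theorem eval_append (g h : List Q) : eval Φ (g ++ h) = eval Φ g * eval Φ h := by
  simp [eval]

theorem eval_singleton (q : Q) : eval Φ [q] = generator Φ q := by
  simp [eval]

theorem actWord_nil_right (g : List Q) : actWord Φ g [] = [] := by
  induction g with
  | nil => rfl
  | cons q g ih => exact ih

theorem actWord_cons_right (g : List Q) (x : X) (w : List X) :
    actWord Φ g (x :: w) = (step Φ x g).2 :: actWord Φ (step Φ x g).1 w := by
  induction g generalizing x w with
  | nil => rfl
  | cons q g ih => simp only [actWord, act, step, ih]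

theorem length_actWord (g : List Q) (w : List X) : (actWord Φ g w).length = w.length := by
  induction w generalizing g with
  | nil => rw [actWord_nil_right]
  | cons x w ih => simp [actWord_cons_right, ih]

theorem actWord_append_right (g : List Q) (u w : List X) :
    actWord Φ g (u ++ w) = actWord Φ g u ++ actWord Φ (stateAt Φ g u) w := by
  induction u generalizing g with
  | nil => simp [actWord_nil_right, stateAt]
  | cons x u ih => simp [actWord_cons_right, ih, stateAt]

theorem step_append (x : X) (g h : List Q) :
    step Φ x (g ++ h) =
      ((step Φ x g).1 ++ (step Φ (step Φ x g).2 h).1, (step Φ (step Φ x g).2 h).2) := by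
  induction g generalizing x with
  | nil => rfl
  | cons q g ih => simp [step, ih]

theorem stateAt_append_left (g h : List Q) (u : List X) :
    stateAt Φ (g ++ h) u = stateAt Φ g u ++ stateAt Φ h (actWord Φ g u) := by
  induction u generalizing g h with
  | nil => simp [stateAt, actWord_nil_right]
  | cons x u ih => simp [stateAt, step_append, ih, actWord_cons_right]

theorem stateAt_append_right (g : List Q) (u v : List X) :
    stateAt Φ g (u ++ v) = stateAt Φ (stateAt Φ g u) v := by
  induction u generalizing g with
  | nil => rfl
  | cons x u ih => exact ih _

theorem length_stateAt (g : List Q) (u : List X) : (stateAt Φ g u).length = g.length := by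
  have hs : ∀ (g : List Q) (x : X), (step Φ x g).1.length = g.length := by
    intro g
    induction g with
    | nil => intro x; rfl
    | cons q g ih => intro x; simp [step, ih]
  induction u generalizing g with
  | nil => rfl
  | cons x u ih => simp [stateAt, ih, hs]

variable {Φ}

/-- The action of `g@u` on `w` is what `g` makes of `u ++ w` beyond the image of `u`. Since actions
preserve length, that part is determined by the value of `g`. -/
theorem eval_stateAt_congr {g h : List Q} (e : eval Φ g = eval Φ h) (u : List X) :
    eval Φ (stateAt Φ g u) = eval Φ (stateAt Φ h u) := by
  rw [eval_eq_iff] at e ⊢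
  funext w
  have h1 := actWord_append_right Φ g u w
  rw [e, actWord_append_right] at h1
  exact ((List.append_inj h1 (by simp [length_actWord])).2).symm

variable (Φ)

/-- Two words have the same value if and only if they agree, and have states of equal value,
at every word of a fixed length. -/
theorem eval_eq_iff_of_depth [Nonempty X] (n : ℕ) (g h : List Q) :
    eval Φ g = eval Φ h ↔ ∀ u : List X, u.length = n →
      actWord Φ g u = actWord Φ h u ∧ eval Φ (stateAt Φ g u) = eval Φ (stateAt Φ h u) := by
  refine ⟨fun e u _ => ⟨by rw [(eval_eq_iff Φ).1 e], eval_stateAt_congr e u⟩, fun H => ?_⟩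
  rw [eval_eq_iff]
  have long : ∀ w : List X, n ≤ w.length → actWord Φ g w = actWord Φ h w := by
    intro w hw
    obtain ⟨h1, h2⟩ := H (w.take n) (by simp [hw])
    rw [eval_eq_iff] at h2
    rw [← List.take_append_drop n w, actWord_append_right, actWord_append_right, h1, h2]
  funext w
  obtain ⟨x⟩ := ‹Nonempty X›
  -- A word shorter than `n` is prolonged, and the images are then cut back to its length.
  have h1 := long (w ++ List.replicate n x) (by simp)
  rw [actWord_append_right, actWord_append_right] at h1
  exact (List.append_inj h1 (by simp [length_actWord])).1

end WordAction

/-! ### Halving words at a fixed depth -/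

section Reduction

variable {X Q : Type} {Φ : X × Q → Q × X}

/-- All states of the empty word are empty, so nuclearity at the empty word provides a state with
trivial value. It serves as padding throughout. -/
theorem IsNuclear.exists_generator_eq_one [Nonempty X] (hΦ : IsNuclear Φ) :
    ∃ e : Q, generator Φ e = 1 := by
  obtain ⟨n, hn⟩ := hΦ []
  obtain ⟨x⟩ := ‹Nonempty X›
  obtain ⟨q, hq⟩ := hn (List.replicate n x) (by simp)
  have h0 : stateAt Φ [] (List.replicate n x) = [] :=
    List.length_eq_zero_iff.1 (by rw [length_stateAt]; rfl)
  rw [h0] at hq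
  exact ⟨q, hq⟩

/-- At depth `n`, every product of two states has the value of a single state. -/
def PairsReduceAtDepth (Φ : X × Q → Q × X) (n : ℕ) : Prop :=
  ∀ (a b : Q) (u : List X), u.length = n → ∃ q : Q, eval Φ (stateAt Φ [a, b] u) = generator Φ q

theorem eval_stateAt_singleton_mem_range (q : Q) (u : List X) :
    eval Φ (stateAt Φ [q] u) ∈ Set.range (generator Φ) := by
  obtain ⟨t, ht⟩ := List.length_eq_one_iff.1 ((length_stateAt Φ [q] u).trans rfl)
  exact ⟨t, by rw [ht, eval_singleton]⟩

/-- The maximum of the depths of the finitely many pairs works: once the value is that of a single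
state it remains so at greater depth. -/
theorem IsNuclear.exists_pairsReduceAtDepth [Finite Q] (hΦ : IsNuclear Φ) :
    ∃ n, PairsReduceAtDepth Φ n := by
  have := Fintype.ofFinite Q
  choose N hN using hΦ
  refine ⟨Finset.univ.sup fun p : Q × Q => N [p.1, p.2], fun a b u hu => ?_⟩
  have hle : N [a, b] ≤ u.length := by
    rw [hu]
    exact Finset.le_sup (f := fun p : Q × Q => N [p.1, p.2]) (Finset.mem_univ (a, b))
  obtain ⟨t, ht⟩ := hN [a, b] (u.take (N [a, b])) (by simp [hle])
  obtain ⟨q, hq⟩ := eval_stateAt_singleton_mem_range (Φ := Φ) t (u.drop (N [a, b]))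
  refine ⟨q, ?_⟩
  rw [hq, ← List.take_append_drop (N [a, b]) u, stateAt_append_right,
    List.take_append_drop]
  rw [← eval_singleton] at ht
  exact (eval_stateAt_congr ht _).symm

theorem wordLength_le (g : List Q) : wordLength Φ (eval Φ g) ≤ g.length :=
  Nat.sInf_le ⟨g, rfl, rfl⟩

theorem exists_length_eq_wordLength (g : List Q) :
    ∃ h : List Q, h.length = wordLength Φ (eval Φ g) ∧ eval Φ h = eval Φ g :=
  Nat.sInf_mem (s := {k : ℕ | ∃ h : List Q, h.length = k ∧ eval Φ h = eval Φ g})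
    ⟨g.length, g, rfl, rfl⟩

/-- Since `(2+1)/2 < 2`, the state of a pair has word length at most 1; length 0 is covered by the
trivial state `e`. -/
theorem HalvesAtDepth.pairsReduceAtDepth {n : ℕ} (hn : HalvesAtDepth Φ n) {e : Q}
    (he : generator Φ e = 1) : PairsReduceAtDepth Φ n := by
  intro a b u hu
  have h1 := hn [a, b] u hu
  have h2 : wordLength Φ (eval Φ [a, b]) ≤ 2 := wordLength_le [a, b]
  have h2' : (wordLength Φ (eval Φ [a, b]) : ℝ) ≤ 2 := by exact_mod_cast h2
  have h3 : wordLength Φ (eval Φ (stateAt Φ [a, b] u)) < 2 := by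
    have : (wordLength Φ (eval Φ (stateAt Φ [a, b] u)) : ℝ) < 2 := by linarith
    exact_mod_cast this
  obtain ⟨h, hl, hh⟩ := exists_length_eq_wordLength (Φ := Φ) (stateAt Φ [a, b] u)
  rw [← hl] at h3
  match h, h3, hh with
  | [], _, hh => exact ⟨e, by rw [← hh, he]; rfl⟩
  | [q], _, hh => exact ⟨q, by rw [← hh, eval_singleton]⟩

/-- A transducer which reads two letters at a time and writes one, with `pad` appended to a word
of odd length: the final state and the output. -/
def compress {A C S : Type} (δ : S → A → A → S × C) (pad : A) : S → List A → S × List C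
  | s, [] => (s, [])
  | s, [a] => ((δ s a pad).1, [(δ s a pad).2])
  | s, a :: b :: w =>
    ((compress δ pad (δ s a b).1 w).1, (δ s a b).2 :: (compress δ pad (δ s a b).1 w).2)

theorem length_compress {A C S : Type} (δ : S → A → A → S × C) (pad : A) (s : S) (w : List A) :
    (compress δ pad s w).2.length = (w.length + 1) / 2 := by
  fun_induction compress δ pad s w with
  | case1 => simp
  | case2 => simp
  | case3 s a b w ih => simp only [List.length_cons, ih]; omega

/-- The action of a word over `Q` on words of length `n`. -/
def actVector (Φ : X × Q → Q × X) {n : ℕ} (g : List Q) (u : List.Vector X n) : List.Vector X n :=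
  ⟨actWord Φ g u.1, by rw [length_actWord, u.2]⟩

/-- The single state that has the value of `[a, b] @ u`. -/
noncomputable def PairsReduceAtDepth.reduce {n : ℕ} (h : PairsReduceAtDepth Φ n) (a b : Q)
    (u : List.Vector X n) : Q :=
  (h a b u.1 u.2).choose

theorem PairsReduceAtDepth.generator_reduce {n : ℕ} (h : PairsReduceAtDepth Φ n) (a b : Q)
    (u : List.Vector X n) : generator Φ (h.reduce a b u) = eval Φ (stateAt Φ [a, b] u.1) :=
  (h a b u.1 u.2).choose_spec.symm

/-- The transition of the transducer that halves words over `Q`. -/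
noncomputable def PairsReduceAtDepth.trans {n : ℕ} (h : PairsReduceAtDepth Φ n)
    (u : List.Vector X n) (a b : Q) : List.Vector X n × Q :=
  (actVector Φ [a, b] u, h.reduce a b u)

/-- By `(gh)@u = (g@u)(h@u^g)`, the only memory needed after a pair `ab` is the image `u^(ab)`.
Padding an odd word with `e` does not change its value. -/
theorem PairsReduceAtDepth.compress_spec {n : ℕ} (h : PairsReduceAtDepth Φ n) {e : Q}
    (he : generator Φ e = 1) (u : List.Vector X n) (g : List Q) :
    (compress h.trans e u g).1 = actVector Φ g u ∧
      eval Φ (compress h.trans e u g).2 = eval Φ (stateAt Φ g u.1) := by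
  induction g using List.twoStepInduction generalizing u with
  | nil =>
    refine ⟨rfl, ?_⟩
    rw [List.length_eq_zero_iff.1 (length_stateAt Φ [] u.1)]
    rfl
  | singleton a =>
    have hae : eval Φ [a, e] = eval Φ [a] := by simp [eval, he]
    refine ⟨Subtype.ext ?_, ?_⟩
    · exact congrFun ((eval_eq_iff Φ).1 hae) u.1
    · rw [compress, eval_singleton]
      exact (h.generator_reduce a e u).trans (eval_stateAt_congr hae u.1)
  | cons_cons a b w ih _ =>
    obtain ⟨h1, h2⟩ := ih (h.trans u a b).1
    refine ⟨by rw [compress, h1]; rfl, ?_⟩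
    rw [compress, show a :: b :: w = [a, b] ++ w from rfl, stateAt_append_left, eval_append,
      ← List.singleton_append, eval_append, h2, eval_singleton]
    congr 1
    exact h.generator_reduce a b u

/-- The transducer is applied to a shortest word for the value of `g`, which is legitimate because
values of states depend only on values. -/
theorem PairsReduceAtDepth.halvesAtDepth {n : ℕ} (h : PairsReduceAtDepth Φ n) {e : Q}
    (he : generator Φ e = 1) : HalvesAtDepth Φ n := by
  intro g v hv
  obtain ⟨u, rfl⟩ : ∃ u : List.Vector X n, u.1 = v := ⟨⟨v, hv⟩, rfl⟩
  obtain ⟨g', hl, hg'⟩ := exists_length_eq_wordLength (Φ := Φ) g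
  have h3 := wordLength_le (Φ := Φ) (compress h.trans e u g').2
  rw [(h.compress_spec he u g').2, eval_stateAt_congr hg' u.1, length_compress, hl] at h3
  rw [le_div_iff₀ (by norm_num)]
  have h4 : wordLength Φ (eval Φ (stateAt Φ g u.1)) * 2 ≤ wordLength Φ (eval Φ g) + 1 := by omega
  exact_mod_cast h4

end Reduction

/-! ### Runs of bounded length -/

section ReachesIn

variable {C : Type*} {f : C → Option C}

/-- `f` leads from `a` to `b` in at most `m` steps. -/
def ReachesIn (f : C → Option C) (m : ℕ) (a b : C) : Prop :=
  ∃ k ≤ m, (flip Bind.bind f)^[k] (some a) = some b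

theorem ReachesIn.refl (a : C) : ReachesIn f 0 a a :=
  ⟨0, le_rfl, rfl⟩

theorem ReachesIn.mono {m m' : ℕ} {a b : C} (h : ReachesIn f m a b) (hm : m ≤ m') :
    ReachesIn f m' a b :=
  let ⟨k, hk, e⟩ := h
  ⟨k, hk.trans hm, e⟩

theorem ReachesIn.trans {m m' : ℕ} {a b c : C} (h : ReachesIn f m a b)
    (h' : ReachesIn f m' b c) : ReachesIn f (m + m') a c := by
  obtain ⟨k, hk, e⟩ := h
  obtain ⟨k', hk', e'⟩ := h'
  exact ⟨k' + k, by omega, by rw [Function.iterate_add_apply, e, e']⟩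

theorem ReachesIn.single {a b : C} (h : f a = some b) : ReachesIn f 1 a b :=
  ⟨1, le_rfl, h⟩

theorem ReachesIn.head {m : ℕ} {a b c : C} (h : f a = some b) (h' : ReachesIn f m b c) :
    ReachesIn f (m + 1) a c :=
  ((ReachesIn.single h).trans h').mono (by omega)

end ReachesIn

/-! A stack machine for problems on words over `A` that reduce, in one pass of a transducer, to
`N` problems on words of half the length. The words still to be treated are kept on the stack
`work`, each one followed by a separator. -/

/-- The stacks of the machine. -/
inductive Stk (N : ℕ)
  | inp
  | out
  | work
  | aux (j : Fin N)
  deriving DecidableEq, Fintype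

/-- The alphabets of the stacks. -/
abbrev Stk.Sym (I A : Type) {N : ℕ} : Stk N → Type
  | inp => I
  | out => Bool
  | work => Option A
  | aux _ => A

/-- The labels of the machine. -/
inductive Lbl (N : ℕ)
  | parse
  | load (k : Fin (N + 1))
  | move (j : Fin N)
  | read
  deriving Fintype

/-- The registers of the machine. -/
structure Reg (A S : Type) where
  flag : Bool
  phase : Bool
  long : Bool
  st : S
  fst : Option (Option A)
  snd : Option (Option A)

instance {A S : Type} [Finite A] [Finite S] : Finite (Reg A S) :=
  Finite.of_injective (fun r : Reg A S => (r.flag, r.phase, r.long, r.st, r.fst, r.snd)) <| by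
    rintro ⟨⟩ ⟨⟩ h
    simpa using h

/-- The data that define the machine: `scan` translates input to a word over `A`, the transducer
has transitions `δ` and initial state `init`, its final states are tested with `acc`, and `base`
settles words of length one. -/
structure HalvingData (I A S : Type) (N : ℕ) where
  scan : Bool → I → Bool × A
  pad : A
  init : S
  δ : S → A → A → S × (Fin N → A)
  acc : S → Bool
  base : A → Bool

/-- The contents of all stacks. -/
def tapes {I A : Type} {N : ℕ} (i : List I) (o : List Bool) (m : List (Option A))
    (x : Fin N → List A) : (k : Stk N) → List (k.Sym I A)
  | .inp => i
  | .out => o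
  | .work => m
  | .aux j => x j

section Stacks

variable {I A : Type} {N : ℕ} (i : List I) (o : List Bool) (m : List (Option A))
  (x : Fin N → List A)

@[simp] theorem tapes_inp : tapes i o m x .inp = i := rfl
@[simp] theorem tapes_out : tapes i o m x .out = o := rfl
@[simp] theorem tapes_work : tapes i o m x .work = m := rfl
@[simp] theorem tapes_aux (j : Fin N) : tapes i o m x (.aux j) = x j := rfl

@[simp] theorem update_tapes_inp (i' : List I) :
    Function.update (tapes i o m x) .inp i' = tapes i' o m x := by
  funext k; cases k <;> simp [Function.update]

@[simp] theorem update_tapes_out (o' : List Bool) :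
    Function.update (tapes i o m x) .out o' = tapes i o' m x := by
  funext k; cases k <;> simp [Function.update]

@[simp] theorem update_tapes_work (m' : List (Option A)) :
    Function.update (tapes i o m x) .work m' = tapes i o m' x := by
  funext k; cases k <;> simp [Function.update]

@[simp] theorem update_tapes_aux (j : Fin N) (y : List A) :
    Function.update (tapes i o m x) (.aux j) y = tapes i o m (Function.update x j y) := by
  funext k
  cases k with
  | aux j' =>
    by_cases h : j' = j
    · subst h; simp
    · rw [Function.update_of_ne (by simpa using h)]; simp [Function.update_of_ne h]
  | _ => simp [Function.update]

end Stacks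

/-! ### The recursive program and its runs -/

namespace HalvingData

variable {I A S : Type} {N : ℕ} (D : HalvingData I A S N)

/-- The type of statements of the machine. -/
abbrev Statement (I A S : Type) (N : ℕ) : Type :=
  Turing.TM2.Stmt (Stk.Sym I A (N := N)) (Lbl N) (Reg A S)

/-- The type of configurations of the machine. -/
abbrev Config (I A S : Type) (N : ℕ) : Type :=
  Turing.TM2.Cfg (Stk.Sym I A (N := N)) (Lbl N) (Reg A S)

/-- The registers at the start of a word. -/
def clear (f : Bool) : Reg A S where
  flag := f
  phase := false
  long := false
  st := D.init
  fst := none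
  snd := none

/-- Push one letter on each auxiliary stack of a list. -/
def pushAll (f : Reg A S → Fin N → A) (l : List (Fin N)) (q : Statement I A S N) :
    Statement I A S N :=
  l.foldr (fun j s => .push (.aux j) (fun v => f v j) s) q

/-- The letter in a register. -/
def letter (r : Option (Option A)) : A := r.join.getD D.pad

open Turing.TM2.Stmt in
/-- The program. -/
def program [NeZero N] : Lbl N → Statement I A S N
  | .parse =>
    pop .inp (fun v c => { v with
      phase := (c.map fun c => (D.scan v.phase c).1).getD v.phase
      fst := c.map fun c => some (D.scan v.phase c).2 }) <|
    branch (fun v => v.fst.isNone)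
      (load (fun _ => D.clear true) <| goto fun _ => .load (Fin.last N))
      (push (.aux 0) (fun v => D.letter v.fst) <| goto fun _ => .parse)
  | .load k =>
    Fin.cases (goto fun _ => .read) (fun j => push .work (fun _ => none) <| goto fun _ => .move j) k
  | .move j =>
    pop (.aux j) (fun v c => { v with fst := c.map some }) <|
    branch (fun v => v.fst.isNone)
      (goto fun _ => .load j.castSucc)
      (push .work (fun v => v.fst.join) <| goto fun _ => .move j)
  | .read =>
    pop .work (fun v c => { v with fst := c }) <|
    -- `fst` is `none` when the stack is exhausted and `some none` at a separator. The register
    -- `long` tells that a pair has been read, so that the outputs on the auxiliary stacks become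
    -- new problems; `flag` is the conjunction of all tests so far.
    branch (fun v => v.fst.isNone)
      (push .out (fun v => v.flag) <| load (fun _ => D.clear true) halt) <|
    branch (fun v => v.fst.join.isNone)
      (branch (fun v => v.long)
        (load (fun v => D.clear (v.flag && D.acc v.st)) <| goto fun _ => .load (Fin.last N))
        (load (fun v => D.clear v.flag) <| goto fun _ => .read)) <|
    pop .work (fun v c => { v with snd := c }) <|
    branch (fun v => v.snd.join.isNone)
      (branch (fun v => v.long)
        (pushAll (fun v => (D.δ v.st (D.letter v.fst) D.pad).2) (List.finRange N) <|
          load (fun v => D.clear (v.flag && D.acc (D.δ v.st (D.letter v.fst) D.pad).1)) <|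
          goto fun _ => .load (Fin.last N))
        (load (fun v => D.clear (v.flag && D.base (D.letter v.fst))) <| goto fun _ => .read))
      (pushAll (fun v => (D.δ v.st (D.letter v.fst) (D.letter v.snd)).2) (List.finRange N) <|
        load (fun v => { v with
          st := (D.δ v.st (D.letter v.fst) (D.letter v.snd)).1
          long := true }) <|
        goto fun _ => .read)

/-- A configuration at a label, with given contents of the stacks. -/
def conf (l : Lbl N) (v : Reg A S) (i : List I) (o : List Bool) (m : List (Option A))
    (x : Fin N → List A) : Config I A S N :=
  ⟨some l, v, tapes i o m x⟩

theorem stepAux_pushAll_of_nodup (f : Reg A S → Fin N → A) (q : Statement I A S N) (v : Reg A S)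
    (i : List I) (o : List Bool) (m : List (Option A)) (x : Fin N → List A) {l : List (Fin N)}
    (hl : l.Nodup) :
    Turing.TM2.stepAux (pushAll f l q) v (tapes i o m x) =
      Turing.TM2.stepAux q v (tapes i o m fun j => if j ∈ l then f v j :: x j else x j) := by
  induction l generalizing x with
  | nil => simp [pushAll]
  | cons a l ih =>
    rw [List.nodup_cons] at hl
    have h : pushAll f (a :: l) q = .push (.aux a) (fun v => f v a) (pushAll f l q) := rfl
    rw [h, Turing.TM2.stepAux, tapes_aux, update_tapes_aux, ih _ hl.2]
    congr 2
    funext j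
    by_cases hj : j = a
    · subst hj; simp [hl.1]
    · simp [hj]

theorem stepAux_pushAll (f : Reg A S → Fin N → A) (q : Statement I A S N) (v : Reg A S)
    (i : List I) (o : List Bool) (m : List (Option A)) (x : Fin N → List A) :
    Turing.TM2.stepAux (pushAll f (List.finRange N) q) v (tapes i o m x) =
      Turing.TM2.stepAux q v (tapes i o m fun j => f v j :: x j) := by
  rw [stepAux_pushAll_of_nodup _ _ _ _ _ _ _ (List.nodup_finRange N)]
  simp

/-- The translation of the input. -/
def scanWord : Bool → List I → List A
  | _, [] => []
  | p, c :: u => (D.scan p c).2 :: scanWord (D.scan p c).1 u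

theorem length_scanWord (p : Bool) (u : List I) : (D.scanWord p u).length = u.length := by
  induction u generalizing p with
  | nil => rfl
  | cons c u ih => simp [scanWord, ih]

variable [NeZero N]

/-- Pushing reverses the word; the transfer from the auxiliary stack to `work` restores its order.
-/
theorem reachesIn_parse (v : Reg A S) (u : List I) (o : List Bool) (m : List (Option A))
    (x : Fin N → List A) :
    ReachesIn (Turing.TM2.step D.program) (u.length + 1)
      (conf .parse v u o m x)
      (conf (.load (Fin.last N)) (D.clear true) [] o m
        (Function.update x 0 ((D.scanWord v.phase u).reverse ++ x 0))) := by
  induction u generalizing v x with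
  | nil =>
    apply ReachesIn.single
    simp [conf, program, scanWord]
  | cons c u ih =>
    refine ReachesIn.head (b := conf .parse { v with
      phase := (D.scan v.phase c).1
      fst := some (some (D.scan v.phase c).2) } u o m
        (Function.update x 0 ((D.scan v.phase c).2 :: x 0))) ?_ ?_
    · simp [conf, program, letter]
    · convert ih _ (Function.update x 0 ((D.scan v.phase c).2 :: x 0)) using 2 <;> simp [scanWord]

theorem reachesIn_move (j : Fin N) (v : Reg A S) (i : List I) (o : List Bool)
    (m : List (Option A)) (x : Fin N → List A) :
    ReachesIn (Turing.TM2.step D.program) ((x j).length + 1)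
      (conf (.move j) v i o m x)
      (conf (.load j.castSucc) { v with fst := none } i o ((x j).reverse.map some ++ m)
        (Function.update x j [])) := by
  generalize hy : x j = y
  induction y generalizing v m x with
  | nil =>
    apply ReachesIn.single
    simp [conf, program, hy]
  | cons a y ih =>
    refine ReachesIn.head (b := conf (.move j) { v with fst := some (some a) } i o (some a :: m)
      (Function.update x j y)) ?_ ?_
    · simp [conf, program, hy]
    · convert ih _ _ (Function.update x j y) (by simp) using 2 <;> simp

/-- The content of the stack `work` that holds a list of words. -/
def encodeWords (ws : List (List A)) : List (Option A) :=
  ws.flatMap fun w => w.map some ++ [none]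

theorem encodeWords_cons (w : List A) (ws : List (List A)) :
    encodeWords (w :: ws) = w.map some ++ none :: encodeWords ws := by
  simp [encodeWords]

theorem encodeWords_append (ws ws' : List (List A)) :
    encodeWords (ws ++ ws') = encodeWords ws ++ encodeWords ws' := by
  simp [encodeWords]

/-- The stacks are emptied from index `k - 1` down to 0, so the word of index 0 ends on top. The
family `y` holds the original contents, fixed during the induction, while `x` loses the stacks
already emptied. -/
theorem reachesIn_load (k : Fin (N + 1)) (v : Reg A S) (hv : v.fst = none) (i : List I)
    (o : List Bool) (m : List (Option A)) (x y : Fin N → List A)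
    (hxy : ∀ j, j.castSucc < k → x j = y j) {L : ℕ} (hL : ∀ j, (y j).length ≤ L) :
    ReachesIn (Turing.TM2.step D.program) (k * (L + 2) + 1)
      (conf (.load k) v i o m x)
      (conf .read v i o
        (encodeWords (((List.finRange N).take k).map fun j => (y j).reverse) ++ m)
        (fun j => if j.castSucc < k then [] else x j)) := by
  induction k using Fin.induction generalizing m x with
  | zero =>
    refine (ReachesIn.single ?_).mono (by omega)
    simp [conf, program, encodeWords]
  | succ j ih =>
    have hv' : ({ v with fst := none } : Reg A S) = v := by rw [← hv]
    have h1 := D.reachesIn_move j v i o (none :: m) x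
    rw [hv'] at h1
    have h2 := ih ((x j).reverse.map some ++ none :: m) (Function.update x j []) fun j' h => by
      rw [Function.update_of_ne (by rintro rfl; exact lt_irrefl _ h)]
      exact hxy j' (h.trans (Fin.castSucc_lt_succ))
    have h3 : ReachesIn (Turing.TM2.step D.program) _ (conf (.load j.succ) v i o m x) _ :=
      ReachesIn.head (b := conf (.move j) v i o (none :: m) x) (by simp [conf, program])
        (h1.trans h2)
    have hj := hxy j Fin.castSucc_lt_succ
    convert h3.mono (m' := (j.succ : ℕ) * (L + 2) + 1) ?_ using 2
    · rw [Fin.val_succ, List.take_succ_eq_append_getElem (by simp), List.map_append,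
        encodeWords_append]
      simp [encodeWords, hj]
    · funext j'
      by_cases h : j' = j
      · subst h; simp
      · have : j'.castSucc < j.succ ↔ j'.castSucc < j.castSucc := by
          simp only [Fin.lt_def, Fin.val_castSucc, Fin.val_succ, Fin.ext_iff] at h ⊢
          omega
        simp [this, h]
    · have := hL j
      rw [← hj] at this
      simp only [Fin.val_castSucc, Fin.val_succ]
      nlinarith

theorem reachesIn_load_last (f : Bool) (i : List I) (o : List Bool) (m : List (Option A))
    (x : Fin N → List A) {L : ℕ} (hL : ∀ j, (x j).length ≤ L) :
    ReachesIn (Turing.TM2.step D.program) (N * (L + 2) + 1)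
      (conf (.load (Fin.last N)) (D.clear f) i o m x)
      (conf .read (D.clear f) i o
        (encodeWords ((List.finRange N).map fun j => (x j).reverse) ++ m) fun _ => []) := by
  have h := D.reachesIn_load (Fin.last N) (D.clear f) rfl i o m x x (fun _ _ => rfl) hL
  rw [Fin.val_last, List.take_of_length_le (by simp)] at h
  simpa [Fin.castSucc_lt_last] using h

/-- One pass over a word from inside the word. -/
theorem reachesIn_read_of_long (w : List A) (v : Reg A S) (hv : v.long = true) (i : List I)
    (o : List Bool) (m : List (Option A)) (x : Fin N → List A) :
    ReachesIn (Turing.TM2.step D.program) (w.length / 2 + 1)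
      (conf .read v i o (w.map some ++ none :: m) x)
      (conf (.load (Fin.last N)) (D.clear (v.flag && D.acc (compress D.δ D.pad v.st w).1)) i o m
        fun j => ((compress D.δ D.pad v.st w).2.map fun c => c j).reverse ++ x j) := by
  induction w using List.twoStepInduction generalizing v x with
  | nil =>
    refine (ReachesIn.single ?_).mono (by omega)
    simp [conf, program, hv, compress]
  | singleton a =>
    refine (ReachesIn.single ?_).mono (by omega)
    simp [conf, program, hv, compress, letter, stepAux_pushAll]
  | cons_cons a b w ih _ =>
    refine (ReachesIn.head (b := conf .read { v with
      fst := some (some a)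
      snd := some (some b)
      st := (D.δ v.st a b).1
      long := true } i o (w.map some ++ none :: m) fun j => (D.δ v.st a b).2 j :: x j) ?_ ?_).mono
      (m := w.length / 2 + 1 + 1) (by simp only [List.length_cons]; omega)
    · simp [conf, program, letter, stepAux_pushAll]
    · convert ih { v with
        fst := some (some a)
        snd := some (some b)
        st := (D.δ v.st a b).1
        long := true } rfl _ using 2 <;> simp [compress]

/-- The problem `P` is settled by the data: words of length at most one by `base`, and other words
by one pass of the transducer, which reduces them to its outputs. -/
structure Decides (P : List A → Bool) : Prop where
  nil : P [] = true
  singleton : ∀ a, P [a] = D.base a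
  cons_cons : ∀ a b w, P (a :: b :: w) =
    (D.acc (compress D.δ D.pad D.init (a :: b :: w)).1 && (List.finRange N).all fun j =>
      P ((compress D.δ D.pad D.init (a :: b :: w)).2.map fun c => c j))

/-- A bound for the time needed for a word of length at most `2 ^ k`. -/
def wordTime (N : ℕ) : ℕ → ℕ
  | 0 => 1
  | k + 1 => 2 ^ k + 1 + (N * (2 ^ k + 2) + 1) + N * wordTime N k

/-- Each word is settled completely, including the subproblems it spawns, before the next one comes
to the top; the stack below it is untouched. -/
theorem reachesIn_words {P : List A → Bool} {t k : ℕ}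
    (H : ∀ (w : List A), w.length ≤ 2 ^ k → ∀ (f : Bool) (m : List (Option A)),
      ReachesIn (Turing.TM2.step D.program) t
        (conf .read (D.clear f) [] [] (w.map some ++ none :: m) fun _ => [])
        (conf .read (D.clear (f && P w)) [] [] m fun _ => []))
    (ws : List (List A)) (hws : ∀ w ∈ ws, w.length ≤ 2 ^ k) (f : Bool) (m : List (Option A)) :
    ReachesIn (Turing.TM2.step D.program) (ws.length * t)
      (conf .read (D.clear f) [] [] (encodeWords ws ++ m) fun _ => [])
      (conf .read (D.clear (f && ws.all P)) [] [] m fun _ => []) := by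
  induction ws generalizing f with
  | nil => simpa [encodeWords] using (ReachesIn.refl _).mono (Nat.zero_le _)
  | cons w ws ih =>
    rw [List.forall_mem_cons] at hws
    have h := (H w hws.1 f (encodeWords ws ++ m)).trans (ih hws.2 _)
    rw [encodeWords_cons, List.append_assoc, List.cons_append, List.all_cons, ← Bool.and_assoc]
    exact h.mono (by rw [List.length_cons]; linarith)

/-- A word of length at most `2 ^ (k + 1)` costs one pass over its pairs, the transfer of `N`
outputs of length at most `2 ^ k`, and the treatment of these by induction. -/
theorem reachesIn_word {P : List A → Bool} (hP : D.Decides P) (k : ℕ) (w : List A)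
    (hw : w.length ≤ 2 ^ k) (f : Bool) (m : List (Option A)) :
    ReachesIn (Turing.TM2.step D.program) (wordTime N k)
      (conf .read (D.clear f) [] [] (w.map some ++ none :: m) fun _ => [])
      (conf .read (D.clear (f && P w)) [] [] m fun _ => []) := by
  have pos : ∀ k, 1 ≤ wordTime N k := by
    intro k
    cases k with
    | zero => exact le_rfl
    | succ k => exact Nat.le_add_right_of_le (Nat.le_add_right_of_le (Nat.le_add_left 1 _))
  induction k generalizing w f m with
  | zero =>
    match w, hw with
    | [], _ =>
      refine ReachesIn.single ?_
      simp [conf, program, clear, hP.nil]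
    | [a], _ =>
      refine ReachesIn.single ?_
      simp [conf, program, clear, letter, hP.singleton]
  | succ k ih =>
    match w, hw with
    | [], _ =>
      refine (ReachesIn.single ?_).mono (pos _)
      simp [conf, program, clear, hP.nil]
    | [a], _ =>
      refine (ReachesIn.single ?_).mono (pos _)
      simp [conf, program, clear, letter, hP.singleton]
    | a :: b :: w, hw =>
      rw [hP.cons_cons]
      set out := (compress D.δ D.pad D.init (a :: b :: w)).2 with hout
      have hlen : out.length ≤ 2 ^ k := by
        rw [hout, length_compress, pow_succ] at *
        omega
      have h1 : ReachesIn (Turing.TM2.step D.program) (2 ^ k + 1)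
          (conf .read (D.clear f) [] [] ((a :: b :: w).map some ++ none :: m) fun _ => [])
          (conf (.load (Fin.last N))
            (D.clear (f && D.acc (compress D.δ D.pad D.init (a :: b :: w)).1)) [] [] m
            fun j => (out.map fun c => c j).reverse) := by
        -- The first pair is read while `long` is still false; that single step is `hs`, and the
        -- rest of the pass starts from its result.
        have h := D.reachesIn_read_of_long w { D.clear f with
          fst := some (some a)
          snd := some (some b)
          st := (D.δ D.init a b).1
          long := true } rfl [] [] m fun j => [(D.δ D.init a b).2 j]
        have hs : Turing.TM2.step D.program
            (conf .read (D.clear f) [] [] ((a :: b :: w).map some ++ none :: m) fun _ => []) =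
            some (conf .read { D.clear f with
              fst := some (some a)
              snd := some (some b)
              st := (D.δ D.init a b).1
              long := true } [] [] (w.map some ++ none :: m) fun j => [(D.δ D.init a b).2 j]) := by
          simp [conf, program, clear, letter, stepAux_pushAll]
        convert (ReachesIn.head hs h).mono (m' := 2 ^ k + 1) ?_ using 2
        · simp [compress, clear]
        · simp [hout, compress]
        · rw [List.length_cons, List.length_cons, pow_succ] at hw
          omega
      have h2 := D.reachesIn_load_last (f && D.acc (compress D.δ D.pad D.init (a :: b :: w)).1)
        [] [] m (fun j => (out.map fun c => c j).reverse) (L := 2 ^ k) (by simpa using hlen)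
      have h3 := D.reachesIn_words ih ((List.finRange N).map fun j => (out.map fun c => c j))
        (by simpa using fun _ : Fin N => hlen)
        (f && D.acc (compress D.δ D.pad D.init (a :: b :: w)).1) m
      simp only [List.reverse_reverse] at h2
      convert (h1.trans h2).trans h3 using 1
      · simp [wordTime]
      · rw [List.all_map, ← Bool.and_assoc]
        rfl

/-- The machine halts with the answer on the stack `out`. -/
theorem reachesIn_halt {P : List A → Bool} (hP : D.Decides P) (u : List I) :
    ReachesIn (Turing.TM2.step D.program)
      (u.length + 1 + (N * (u.length + 2) + 1) + N * wordTime N (Nat.clog 2 u.length) + 1)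
      (conf .parse (D.clear true) u [] [] fun _ => [])
      ⟨none, D.clear true, tapes [] [P (D.scanWord false u)] [] fun _ => []⟩ := by
  -- The initial transfer handles all `N` stacks, although only stack 0 is filled. The other words
  -- are empty and pass the test by `hP.nil`.
  set x : Fin N → List A :=
    Function.update (fun _ => []) 0 (D.scanWord false u).reverse with hx
  have hxl : ∀ j, (x j).length ≤ u.length := by
    intro j
    by_cases h : j = 0
    · subst h; simp [hx, length_scanWord]
    · simp [hx, h]
  have h1 := D.reachesIn_parse (D.clear true) u [] [] fun _ => []
  rw [List.append_nil] at h1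
  have h2 := D.reachesIn_load_last true [] [] [] x hxl
  have h3 := D.reachesIn_words (D.reachesIn_word hP (Nat.clog 2 u.length))
    ((List.finRange N).map fun j => (x j).reverse)
    (by simpa using fun j => (hxl j).trans (Nat.le_pow_clog one_lt_two _)) true []
  have h4 : Turing.TM2.step D.program
      (conf .read (D.clear (P (D.scanWord false u))) [] [] [] fun _ => []) =
      some ⟨none, D.clear true, tapes [] [P (D.scanWord false u)] [] fun _ => []⟩ := by
    simp [conf, program, clear]
  have hall : ((List.finRange N).map fun j => (x j).reverse).all P = P (D.scanWord false u) := by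
    rw [Bool.eq_iff_iff, List.all_map, List.all_eq_true]
    constructor
    · intro h
      simpa [hx] using h 0 (List.mem_finRange 0)
    · intro h j _
      by_cases hj : j = 0
      · subst hj; simpa [hx] using h
      · simp [hx, hj, hP.nil]
  rw [hall, Bool.true_and] at h3
  rw [List.length_map, List.length_finRange] at h3
  exact ((h1.trans h2).trans h3).trans (ReachesIn.single h4)

end HalvingData

/-! ### The machine and its running time -/

namespace HalvingData

section Machine

variable {I A S : Type} {N : ℕ} (D : HalvingData I A S N) [NeZero N] [Fintype I] [Finite A]
  [Finite S]

/-- The machine. -/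
noncomputable def machine : Turing.FinTM2 where
  K := Stk N
  k₀ := .inp
  k₁ := .out
  Γ := Stk.Sym I A
  Λ := Lbl N
  main := .parse
  σ := Reg A S
  initialState := D.clear true
  σFin := Fintype.ofFinite _
  Γk₀Fin := ‹Fintype I›
  m := D.program

theorem initList_machine (u : List I) :
    Turing.initList D.machine u = conf .parse (D.clear true) u [] [] fun _ => [] := by
  refine congrArg (Turing.TM2.Cfg.mk (some Lbl.parse) (D.clear true)) ?_
  funext k
  cases k <;> rfl

theorem haltList_machine (o : List Bool) :
    Turing.haltList D.machine o = ⟨none, D.clear true, tapes [] o [] fun _ => []⟩ := by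
  refine congrArg (Turing.TM2.Cfg.mk none (D.clear true)) ?_
  funext k
  cases k <;> rfl

/-- The running time of the machine on inputs of length `L`. -/
def runTime (N L : ℕ) : ℕ :=
  L + 1 + (N * (L + 2) + 1) + N * wordTime N (Nat.clog 2 L) + 1

theorem nonempty_outputsInTime {P : List A → Bool} (hP : D.Decides P) (u : List I) {t : ℕ}
    (ht : runTime N u.length ≤ t) :
    Nonempty (Turing.TM2OutputsInTime D.machine u (some [P (D.scanWord false u)]) t) := by
  obtain ⟨k, hk, e⟩ := D.reachesIn_halt hP u
  refine ⟨⟨⟨k, ?_⟩, hk.trans ht⟩⟩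
  exact (congrArg (fun c => (flip Bind.bind D.machine.step)^[k] (some c))
    (D.initList_machine u)).trans (e.trans (congrArg some (D.haltList_machine _).symm))

end Machine

section Time

theorem wordTime_succ_le (N k : ℕ) :
    wordTime N (k + 1) ≤ 3 * (N + 1) * 2 ^ k + N * wordTime N k := by
  have h1 : 1 ≤ 2 ^ k := Nat.one_le_two_pow
  rw [wordTime]
  nlinarith

/-- The added term closes the induction: with `c = 3 * (M + 1)`, the cost `c * 2 ^ k` of a pass and
the new term `c * 2 ^ (k + 1)` sum to `3 * c * 2 ^ k`, at most `M` times the old term since `M ≥ 3`.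
The constant `3 * M + 4` is the value at `k = 0`. -/
theorem wordTime_add_le {N M : ℕ} (hNM : N ≤ M) (hM : 3 ≤ M) (k : ℕ) :
    wordTime N k + 3 * (M + 1) * 2 ^ k ≤ (3 * M + 4) * M ^ k := by
  induction k with
  | zero => simp [wordTime]; omega
  | succ k ih =>
    have h1 := wordTime_succ_le N k
    have h2 : 3 * (N + 1) * 2 ^ k ≤ 3 * (M + 1) * 2 ^ k := by gcongr
    have h3 : N * wordTime N k ≤ M * wordTime N k := by gcongr
    have h4 : 3 * (3 * (M + 1) * 2 ^ k) ≤ M * (3 * (M + 1) * 2 ^ k) := by gcongr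
    have h5 := Nat.mul_le_mul_left M ih
    rw [pow_succ, pow_succ]
    nlinarith

/-- With at most two subproblems of half the size, every level of the recursion costs `O(2 ^ k)`,
whence the factor `k`. -/
theorem wordTime_le_of_le_two {N : ℕ} (hN : N ≤ 2) (k : ℕ) :
    wordTime N k ≤ (1 + 9 * k) * 2 ^ k := by
  induction k with
  | zero => simp [wordTime]
  | succ k ih =>
    have h1 := wordTime_succ_le N k
    have h2 : 3 * (N + 1) * 2 ^ k ≤ 9 * 2 ^ k := by gcongr; omega
    have h3 : N * wordTime N k ≤ 2 * ((1 + 9 * k) * 2 ^ k) := by gcongr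
    rw [pow_succ]
    nlinarith

theorem two_pow_clog_le {L : ℕ} (hL : 1 ≤ L) : 2 ^ Nat.clog 2 L ≤ 2 * L := by
  rcases hL.eq_or_lt with rfl | hL
  · simp
  · have h := Nat.pow_pred_clog_lt_self one_lt_two hL
    have hpos := Nat.clog_pos one_lt_two hL
    obtain ⟨k, hk⟩ := Nat.exists_eq_succ_of_ne_zero hpos.ne'
    rw [hk] at h ⊢
    rw [pow_succ]
    simp only [Nat.succ_eq_add_one, Nat.pred_eq_sub_one, Nat.add_sub_cancel] at h
    omega

theorem exists_polynomial_runTime_le (N : ℕ) :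
    ∃ p : Polynomial ℕ, ∀ L, 1 ≤ L → runTime N L ≤ p.eval L := by
  -- A power of 2 above both `N` and 3, so that `M ^ clog L` is a natural power of `2 ^ clog L ≤ 2 *
  -- L`.
  set M := 2 ^ (N + 2) with hM
  have hNM : N ≤ M := (Nat.lt_two_pow_self.le).trans (Nat.pow_le_pow_right two_pos (by omega))
  have hM3 : 3 ≤ M := by
    have : 2 ^ 2 ≤ M := Nat.pow_le_pow_right two_pos (by omega)
    omega
  refine ⟨Polynomial.X + 1 + (Polynomial.C N * (Polynomial.X + 2) + 1) +
    Polynomial.C N * (Polynomial.C (3 * M + 4) * (2 * Polynomial.X) ^ (N + 2)) + 1,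
    fun L hL => ?_⟩
  have h1 := wordTime_add_le hNM hM3 (Nat.clog 2 L)
  have h2 : M ^ Nat.clog 2 L ≤ (2 * L) ^ (N + 2) := by
    rw [hM, ← pow_mul, mul_comm, pow_mul]
    exact Nat.pow_le_pow_left (two_pow_clog_le hL) _
  have h3 : wordTime N (Nat.clog 2 L) ≤ (3 * M + 4) * (2 * L) ^ (N + 2) :=
    (Nat.le_of_add_right_le h1).trans (by gcongr)
  simp only [Polynomial.eval_add, Polynomial.eval_mul, Polynomial.eval_pow, Polynomial.eval_X,
    Polynomial.eval_C, Polynomial.eval_one, Polynomial.eval_ofNat, runTime]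
  gcongr

/-- With `d = log₂ N`, the count `N ^ clog L = (2 ^ clog L) ^ d` is at most `(2 * L) ^ d = N * L ^
d`; the linear terms are absorbed because `d > 1`. -/
theorem isBigO_runTime_rpow {N : ℕ} (hN : 2 < N) :
    (fun L : ℕ => (runTime N L : ℝ)) =O[atTop] fun L : ℕ => (L : ℝ) ^ Real.logb 2 N := by
  have hN0 : (0 : ℝ) < N := by exact_mod_cast (by omega : 0 < N)
  have hd : 1 < Real.logb 2 N := by
    rw [Real.lt_logb_iff_rpow_lt one_lt_two hN0, Real.rpow_one]
    exact_mod_cast hN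
  have h2d : (2 : ℝ) ^ Real.logb 2 N = N := Real.rpow_logb two_pos (by norm_num) hN0
  refine IsBigO.of_bound (4 + 3 * N + N * (3 * N + 4) * N) ?_
  filter_upwards [eventually_ge_atTop 1] with L hL
  have hL1 : (1 : ℝ) ≤ L := by exact_mod_cast hL
  set y : ℝ := (L : ℝ) ^ Real.logb 2 N with hy
  have hLy : (L : ℝ) ≤ y := by
    simpa using Real.rpow_le_rpow_of_exponent_le hL1 hd.le
  have hpow : ((N ^ Nat.clog 2 L : ℕ) : ℝ) ≤ N * y := by
    have h1 : ((2 : ℝ) ^ Nat.clog 2 L) ≤ 2 * L := by exact_mod_cast two_pow_clog_le hL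
    have h2 := Real.rpow_le_rpow (by positivity) h1 (zero_le_one.trans hd.le)
    rw [Real.mul_rpow (by norm_num) (by positivity), h2d, ← Real.rpow_natCast,
      ← Real.rpow_mul two_pos.le, mul_comm (Nat.clog 2 L : ℝ), Real.rpow_mul two_pos.le, h2d,
      Real.rpow_natCast] at h2
    exact_mod_cast h2
  have hw : (wordTime N (Nat.clog 2 L) : ℝ) ≤ (3 * N + 4) * (N * y) := by
    have h1 := Nat.le_of_add_right_le (wordTime_add_le le_rfl hN (Nat.clog 2 L))
    have h2 : (wordTime N (Nat.clog 2 L) : ℝ) ≤ (3 * N + 4) * ((N ^ Nat.clog 2 L : ℕ) : ℝ) := by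
      exact_mod_cast h1
    exact h2.trans (by gcongr)
  rw [Real.norm_of_nonneg (by positivity), Real.norm_of_nonneg (by positivity)]
  have hNw := mul_le_mul_of_nonneg_left hw hN0.le
  have hNy := mul_le_mul_of_nonneg_left hLy hN0.le
  have hN1 := mul_le_mul_of_nonneg_left (hL1.trans hLy) hN0.le
  simp only [runTime]
  push_cast
  nlinarith

theorem isBigO_runTime_mul_log {N : ℕ} (hN : N ≤ 2) :
    (fun L : ℕ => (runTime N L : ℝ)) =O[atTop] fun L : ℕ => (L : ℝ) * Real.log L := by
  refine IsBigO.of_bound 200 ?_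
  filter_upwards [eventually_ge_atTop 3] with L hL
  have hL3 : (3 : ℝ) ≤ L := by exact_mod_cast hL
  have hlog : 1 ≤ Real.log L := by
    rw [Real.le_log_iff_exp_le (by linarith)]
    exact Real.exp_one_lt_three.le.trans hL3
  have hclog : (Nat.clog 2 L : ℝ) ≤ 4 * Real.log L := by
    have h1 : ((2 : ℝ) ^ Nat.clog 2 L) ≤ 2 * L := by exact_mod_cast two_pow_clog_le (by omega)
    have h2 := Real.log_le_log (by positivity) h1
    rw [Real.log_pow, Real.log_mul (by norm_num) (by positivity)] at h2
    have h3 := Real.log_two_gt_d9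
    have h4 := Real.log_two_lt_d9
    nlinarith
  have hw : (wordTime N (Nat.clog 2 L) : ℝ) ≤ (1 + 9 * (4 * Real.log L)) * (2 * L) := by
    have h1 : (wordTime N (Nat.clog 2 L) : ℝ) ≤
        (1 + 9 * (Nat.clog 2 L : ℝ)) * (2 ^ Nat.clog 2 L : ℕ) := by
      exact_mod_cast wordTime_le_of_le_two hN _
    have h2 : ((2 ^ Nat.clog 2 L : ℕ) : ℝ) ≤ 2 * L := by
      exact_mod_cast two_pow_clog_le (by omega : 1 ≤ L)
    exact h1.trans (by gcongr)
  rw [Real.norm_of_nonneg (by positivity), Real.norm_of_nonneg (by positivity)]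
  have hN2 : (N : ℝ) ≤ 2 := by exact_mod_cast hN
  have hNw : (N : ℝ) * wordTime N (Nat.clog 2 L) ≤
      2 * ((1 + 9 * (4 * Real.log L)) * (2 * L)) := by gcongr
  have hNL : (N : ℝ) * (L + 2) ≤ 2 * (L + 2) := by gcongr
  have hLl : (L : ℝ) * 1 ≤ L * Real.log L := by gcongr
  simp only [runTime]
  push_cast
  nlinarith

end Time

end HalvingData

/-! ### The word problem as a halving problem -/

section WordProblem

variable {X Q : Type} {Φ : X × Q → Q × X} {n N : ℕ}

/-- The data for the word problem: words over `Q × Q` stand for pairs of words over `Q`. -/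
noncomputable def PairsReduceAtDepth.halvingData (h : PairsReduceAtDepth Φ n) (e : Q)
    (E : Fin N ≃ List.Vector X n) :
    HalvingData (Option Q) (Q × Q) (Fin N → List.Vector X n × List.Vector X n) N where
  scan p c := c.elim (true, (e, e)) fun q => (p, if p then (e, q) else (q, e))
  pad := (e, e)
  init j := (E j, E j)
  δ s a b := (fun j => ((h.trans (s j).1 a.1 b.1).1, (h.trans (s j).2 a.2 b.2).1),
    fun j => ((h.trans (s j).1 a.1 b.1).2, (h.trans (s j).2 a.2 b.2).2))
  acc s := @decide (∀ j, (s j).1 = (s j).2) (Classical.propDecidable _)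
  base a := wordProblem Φ ([a.1], [a.2])

variable (h : PairsReduceAtDepth Φ n) (e : Q) (E : Fin N ≃ List.Vector X n)

/-- The transducer is a product of `2 * N` independent ones, one for each word of the pair and each
element of `X^n`. -/
theorem PairsReduceAtDepth.compress_halvingData
    (s : Fin N → List.Vector X n × List.Vector X n) (w : List (Q × Q)) (j : Fin N) :
    (compress (h.halvingData e E).δ (e, e) s w).1 j =
      ((compress h.trans e (s j).1 (w.map Prod.fst)).1,
        (compress h.trans e (s j).2 (w.map Prod.snd)).1) ∧
    ((compress (h.halvingData e E).δ (e, e) s w).2.map fun c => c j).map Prod.fst =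
      (compress h.trans e (s j).1 (w.map Prod.fst)).2 ∧
    ((compress (h.halvingData e E).δ (e, e) s w).2.map fun c => c j).map Prod.snd =
      (compress h.trans e (s j).2 (w.map Prod.snd)).2 := by
  induction w using List.twoStepInduction generalizing s with
  | nil => exact ⟨rfl, rfl, rfl⟩
  | singleton a => exact ⟨rfl, rfl, rfl⟩
  | cons_cons a b w ih _ =>
    obtain ⟨h1, h2, h3⟩ := ih ((h.halvingData e E).δ s a b).1
    exact ⟨h1, congrArg (List.cons _) h2, congrArg (List.cons _) h3⟩

variable {e}

theorem PairsReduceAtDepth.decides_halvingData [Nonempty X] (he : generator Φ e = 1) :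
    (h.halvingData e E).Decides fun w => wordProblem Φ (w.map Prod.fst, w.map Prod.snd) where
  nil := by simp [wordProblem]
  singleton a := rfl
  cons_cons a b w := by
    generalize a :: b :: w = w
    have hs := h.compress_halvingData e E (h.halvingData e E).init w
    rw [Bool.eq_iff_iff, Bool.and_eq_true, List.all_eq_true]
    simp only [wordProblem, decide_eq_true_eq]
    rw [eval_eq_iff_of_depth Φ n]
    have hacc : (h.halvingData e E).acc (compress (h.halvingData e E).δ (h.halvingData e E).pad
        (h.halvingData e E).init w).1 = true ↔
        ∀ j, actVector Φ (w.map Prod.fst) (E j) = actVector Φ (w.map Prod.snd) (E j) := by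
      refine (@decide_eq_true_iff _ (Classical.propDecidable _)).trans (forall_congr' fun j => ?_)
      have h1 := (hs j).1
      rw [(h.compress_spec he _ _).1, (h.compress_spec he _ _).1] at h1
      exact (congrArg (fun p => p.1 = p.2) h1).to_iff
    have hout : ∀ j, (eval Φ (((compress (h.halvingData e E).δ (h.halvingData e E).pad
          (h.halvingData e E).init w).2.map fun c => c j).map Prod.fst) =
        eval Φ (((compress (h.halvingData e E).δ (h.halvingData e E).pad
          (h.halvingData e E).init w).2.map fun c => c j).map Prod.snd)) ↔
        eval Φ (stateAt Φ (w.map Prod.fst) (E j).1) =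
          eval Φ (stateAt Φ (w.map Prod.snd) (E j).1) := by
      intro j
      have h2 := congrArg (eval Φ) (hs j).2.1
      have h3 := congrArg (eval Φ) (hs j).2.2
      rw [(h.compress_spec he _ _).2] at h2 h3
      exact Eq.congr h2 h3
    rw [hacc]
    simp only [hout]
    constructor
    · intro H
      exact ⟨fun j => Subtype.ext (H _ (E j).2).1, fun j _ => (H _ (E j).2).2⟩
    · rintro ⟨H1, H2⟩ u hu
      obtain ⟨j, rfl⟩ : ∃ j, (E j).1 = u :=
        ⟨E.symm ⟨u, hu⟩, congrArg Subtype.val (E.apply_symm_apply ⟨u, hu⟩)⟩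
      exact ⟨congrArg Subtype.val (H1 j), H2 j (List.mem_finRange j)⟩

/-- The two words need not be aligned: the letters of `u` are paired with `e` on the right, the
separator becomes `(e, e)`, and the letters of `v` are paired with `e` on the left. Each coordinate
keeps its value, as `e` acts trivially. -/
theorem PairsReduceAtDepth.wordProblem_scanWord (he : generator Φ e = 1)
    (p : List Q × List Q) :
    wordProblem Φ (((h.halvingData e E).scanWord false (encodePair p)).map Prod.fst,
      ((h.halvingData e E).scanWord false (encodePair p)).map Prod.snd) = wordProblem Φ p := by
  obtain ⟨u, v⟩ := p
  have hv : ∀ v : List Q,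
      eval Φ (((h.halvingData e E).scanWord true (v.map some)).map Prod.fst) = 1 ∧
      eval Φ (((h.halvingData e E).scanWord true (v.map some)).map Prod.snd) = eval Φ v := by
    intro v
    induction v with
    | nil => exact ⟨rfl, rfl⟩
    | cons q v ih =>
      have hcons : (h.halvingData e E).scanWord true ((q :: v).map some) =
        (e, q) :: (h.halvingData e E).scanWord true (v.map some) := rfl
      rw [hcons]
      simp only [eval, List.map_cons, List.prod_cons, he, one_mul] at ih ⊢
      exact ⟨ih.1, by rw [ih.2]⟩
  have hu : eval Φ (((h.halvingData e E).scanWord false (encodePair (u, v))).map Prod.fst) =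
        eval Φ u ∧
      eval Φ (((h.halvingData e E).scanWord false (encodePair (u, v))).map Prod.snd) =
        eval Φ v := by
    induction u with
    | nil =>
      have hcons : (h.halvingData e E).scanWord false (encodePair ([], v)) =
        (e, e) :: (h.halvingData e E).scanWord true (v.map some) := rfl
      have h2 := hv v
      rw [hcons]
      simp only [eval, List.map_cons, List.prod_cons, he, one_mul] at h2 ⊢
      exact h2
    | cons q u ih =>
      have hcons : (h.halvingData e E).scanWord false (encodePair (q :: u, v)) =
        (q, e) :: (h.halvingData e E).scanWord false (encodePair (u, v)) := rfl
      rw [hcons]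
      simp only [eval, List.map_cons, List.prod_cons, he, one_mul] at ih ⊢
      exact ⟨by rw [ih.1], ih.2⟩
  rw [wordProblem, wordProblem, hu.1, hu.2]

theorem PairsReduceAtDepth.nonempty_outputsInTime [Fintype Q] [Finite X] [Nonempty X] [NeZero N]
    (he : generator Φ e = 1) (p : List Q × List Q) {t : ℕ}
    (ht : HalvingData.runTime N (encodePair p).length ≤ t) :
    Nonempty (Turing.TM2OutputsInTime (h.halvingData e E).machine (encodePair p)
      (some (Computability.encodeBool (wordProblem Φ p))) t) := by
  have := (h.halvingData e E).nonempty_outputsInTime (h.decides_halvingData E he) (encodePair p) ht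
  rw [h.wordProblem_scanWord E he] at this
  exact this

end WordProblem

end MealyAutomaton

/-! ### Solvability and the bound on the degree -/

theorem mainTheorem6 {X Q : Type} [Finite X] [Nonempty X] [Finite Q]
    (Φ : X × Q → Q × X) (hΦ : MealyAutomaton.IsNuclear Φ) :
    -- the word problem is solved by a multi-stack Turing machine in polynomial time
    Nonempty (Turing.TM2ComputableInPolyTime MealyAutomaton.encodePair Computability.encodeBool
      (MealyAutomaton.wordProblem Φ)) ∧
    -- there is a depth at which word length halves
    (∃ n : ℕ, MealyAutomaton.HalvesAtDepth Φ n) ∧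
    -- each such depth bounds the degree
    ∀ n : ℕ, MealyAutomaton.HalvesAtDepth Φ n →
      ∃ M : Turing.TM2ComputableInTime MealyAutomaton.encodePair Computability.encodeBool
          (MealyAutomaton.wordProblem Φ),
        (1 < (n : ℝ) * Real.logb 2 (Nat.card X) →
          (fun N : ℕ => (M.time N : ℝ)) =O[atTop]
            fun N : ℕ => (N : ℝ) ^ ((n : ℝ) * Real.logb 2 (Nat.card X))) ∧
        ((n : ℝ) * Real.logb 2 (Nat.card X) ≤ 1 →
          (fun N : ℕ => (M.time N : ℝ)) =O[atTop] fun N : ℕ => (N : ℝ) * Real.log N) := by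
  have := Fintype.ofFinite X
  have := Fintype.ofFinite Q
  obtain ⟨e, he⟩ := hΦ.exists_generator_eq_one
  have hcard : ∀ n, Fintype.card (List.Vector X n) = Nat.card X ^ n := fun n => by
    rw [card_vector, Nat.card_eq_fintype_card]
  have hne : ∀ n, NeZero (Nat.card X ^ n) := fun n => ⟨pow_ne_zero _ Nat.card_pos.ne'⟩
  have hE : ∀ n, Nonempty (Fin (Nat.card X ^ n) ≃ List.Vector X n) := fun n =>
    ⟨(finCongr (hcard n).symm).trans (Fintype.equivFin _).symm⟩
  refine ⟨?_, ?_, ?_⟩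
  · obtain ⟨n, hn⟩ := hΦ.exists_pairsReduceAtDepth
    obtain ⟨E⟩ := hE n
    have := hne n
    obtain ⟨p, hp⟩ := MealyAutomaton.HalvingData.exists_polynomial_runTime_le (Nat.card X ^ n)
    refine ⟨⟨⟨(hn.halvingData e E).machine, Equiv.refl _, Equiv.refl _⟩, p, fun a => ?_⟩⟩
    -- The separator makes the encoded input nonempty, as the polynomial bound requires.
    have hout := hn.nonempty_outputsInTime E he a
      (hp _ (by rw [MealyAutomaton.encodePair, List.length_append, List.length_cons]; omega))
    refine Classical.choice ?_
    exact (congrArg₂ (fun i o => Nonempty (Turing.TM2OutputsInTime (hn.halvingData e E).machine i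
      (some o) _)) (List.map_id _) (List.map_id _)).mpr hout
  · obtain ⟨n, hn⟩ := hΦ.exists_pairsReduceAtDepth
    exact ⟨n, hn.halvesAtDepth he⟩
  · intro n hn
    have hn := hn.pairsReduceAtDepth he
    obtain ⟨E⟩ := hE n
    have := hne n
    refine ⟨⟨⟨(hn.halvingData e E).machine, Equiv.refl _, Equiv.refl _⟩,
      MealyAutomaton.HalvingData.runTime (Nat.card X ^ n), fun a => ?_⟩, ?_⟩
    · have hout := hn.nonempty_outputsInTime E he a le_rfl
      refine Classical.choice ?_
      exact (congrArg₂ (fun i o => Nonempty (Turing.TM2OutputsInTime (hn.halvingData e E).machine i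
        (some o) _)) (List.map_id _) (List.map_id _)).mpr hout
    · have hpos : (0 : ℝ) < (Nat.card X ^ n : ℕ) := by
        exact_mod_cast Nat.pos_of_ne_zero (hne n).ne
      -- The exponent `d` is the base 2 logarithm of the number `#X^n` of subproblems, so `d > 1`
      -- means more than two of them.
      have hd : (n : ℝ) * Real.logb 2 (Nat.card X) = Real.logb 2 ((Nat.card X ^ n : ℕ) : ℝ) := by
        rw [Nat.cast_pow, Real.logb_pow]
      rw [hd]
      refine ⟨fun h => MealyAutomaton.HalvingData.isBigO_runTime_rpow ?_,
        fun h => MealyAutomaton.HalvingData.isBigO_runTime_mul_log ?_⟩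
      · rw [Real.lt_logb_iff_rpow_lt one_lt_two hpos, Real.rpow_one] at h
        exact_mod_cast h
      · rw [Real.logb_le_iff_le_rpow one_lt_two hpos, Real.rpow_one] at h
        exact_mod_cast h
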